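/- For a nonzero polynomial $P\in\mathbb C[z]$ define Mahler's measure $$M(P):=\exp\left(\frac1{2\pi}\int_0^{2\pi}\log|P(e^{i\theta})|\,d\theta\right)$$ and its areal analogue (the $A^0$ Bergman space norm) $$\|P\|_0:=\exp\left(\frac1\pi\iint_{\mathbb D}\log|P(z)|\,dA(z)\right),$$ where $\mathbb D=\{z\in\mathbb C:|z|<1\}$ is the open unit disk and $dA$ is area measure. Let $P_n(z)=\sum_{k=0}^n a_kz^k$ be a polynomial with integer coefficients that is not identically zero. If $P_n$ has at least one zero in $\mathbb D$, then $\|P_n\|_0$ is a transcendental number. Otherwise, $\|P_n\|_0=M(P_n)=|a_0|$ is an integer. -/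

import Mathlib

/-- The `A⁰` Bergman space norm `‖p‖₀ = exp ((1 / π) ∬_D log |p(z)| dA)` of a complex polynomial:
`D` is the open unit disk and `dA` is Lebesgue (area) measure on the complex plane. For `p = 0` the
integral is `-∞`, and the value is `exp (-∞) = 0`, the same convention as for
`Polynomial.mahlerMeasure`. -/
noncomputable def arealMahlerMeasure (p : Polynomial ℂ) : ℝ :=
  if p = 0 then 0
  else Real.exp
    ((1 / Real.pi) * ∫ z in Metric.ball (0 : ℂ) 1, Real.log ‖p.eval z‖ ∂MeasureTheory.volume)

theorem integrableOn_log_norm_ball (R : ℝ) :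
    MeasureTheory.IntegrableOn (fun z : ℂ => Real.log ‖z‖) (Metric.ball 0 R) := by
  have h := (MeasureTheory.integrable_fun_norm_addHaar (E := ℂ) MeasureTheory.volume
    (f := (Set.Iio R).indicator Real.log)).2 ?_
  · rw [← MeasureTheory.integrable_indicator_iff Metric.isOpen_ball.measurableSet]
    refine h.congr (Filter.Eventually.of_forall fun z => ?_)
    by_cases hz : ‖z‖ < R <;> simp [Set.indicator, hz]
  · have h1 : MeasureTheory.IntegrableOn (fun y : ℝ => y * Real.log y) (Set.Ioo 0 R) :=
      (Real.continuous_mul_log.integrableOn_Icc).mono_set Set.Ioo_subset_Icc_self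
    have h2 := (MeasureTheory.integrable_indicator_iff measurableSet_Iio).2
      ((show MeasureTheory.IntegrableOn (fun y : ℝ => y * Real.log y) (Set.Iio R)
        (MeasureTheory.volume.restrict (Set.Ioi 0)) by
        rw [MeasureTheory.IntegrableOn, MeasureTheory.Measure.restrict_restrict measurableSet_Iio,
          Set.inter_comm, Set.Ioi_inter_Iio]
        exact h1))
    refine h2.congr (Filter.Eventually.of_forall fun y => ?_)
    by_cases hy : y < R <;> simp [Set.indicator, hy, Complex.finrank_real_complex]

/-- The integral in the definition of `arealMahlerMeasure` always converges for `p ≠ 0`. -/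
theorem integrableOn_log_norm_eval (p : Polynomial ℂ) (hp : p ≠ 0) :
    MeasureTheory.IntegrableOn (fun z : ℂ => Real.log ‖p.eval z‖) (Metric.ball 0 1) := by
  induction hn : p.natDegree generalizing p with
  | zero =>
    obtain ⟨c, rfl⟩ := Polynomial.natDegree_eq_zero.1 hn
    simp
  | succ n ih =>
    obtain ⟨a, ha⟩ := IsAlgClosed.exists_root p
      (fun h => by simp [Polynomial.natDegree_eq_of_degree_eq_some h] at hn)
    obtain ⟨q, rfl⟩ := Polynomial.dvd_iff_isRoot.2 ha
    have hq : q ≠ 0 := right_ne_zero_of_mul hp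
    have hdeg : q.natDegree = n := by
      rw [Polynomial.natDegree_mul (Polynomial.X_sub_C_ne_zero a) hq,
        Polynomial.natDegree_X_sub_C] at hn
      omega
    have hlin : MeasureTheory.IntegrableOn (fun z : ℂ => Real.log ‖z - a‖) (Metric.ball 0 1) := by
      have h := (MeasureTheory.integrable_indicator_iff Metric.isOpen_ball.measurableSet).2
        (integrableOn_log_norm_ball (1 + ‖a‖))
      refine ((h.comp_sub_right a).integrableOn (s := Metric.ball 0 1)).congr_fun
        (fun z hz => ?_) Metric.isOpen_ball.measurableSet
      have hz' : ‖z‖ < 1 := by simpa using hz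
      have : ‖z - a‖ < 1 + ‖a‖ := (norm_sub_le z a).trans_lt (by linarith)
      simp [Set.indicator, this]
    refine (hlin.add (ih q hq hdeg)).congr ?_
    have hfin : ∀ᵐ z : ℂ, z ∉ (((Polynomial.X - Polynomial.C a) * q).roots.toFinset : Set ℂ) :=
      (MeasureTheory.measure_eq_zero_iff_ae_notMem).1 (Finset.measure_zero _ _)
    filter_upwards [MeasureTheory.ae_restrict_of_ae hfin] with z hz
    have hz0 : ¬ ((z - a) * q.eval z = 0) := by
      simpa [hp, hq, Polynomial.X_sub_C_ne_zero] using hz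
    rw [mul_eq_zero, not_or] at hz0
    simp [Real.log_mul (norm_ne_zero_iff.2 hz0.1) (norm_ne_zero_iff.2 hz0.2)]

/-!
For a linear polynomial, integrating `log ‖z - a‖` over the unit disk by circles (the mean over the
circle of radius `r` is `log (max r ‖a‖)`) gives
`‖z - a‖₀ = max 1 ‖a‖ * exp ((min 1 ‖a‖ ^ 2 - 1) / 2)`. Since the areal measure is multiplicative,
`‖p‖₀ = M(p) * exp S` with `S` the sum of `(min 1 ‖a‖ ^ 2 - 1) / 2` over the roots `a` of `p`
(`arealMahlerMeasure_eq_mahlerMeasure_mul_exp`).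

For an integer polynomial both `M(p)` and `S` are algebraic, and `S` is a sum of nonpositive terms
that vanishes exactly when no root lies in the open disk. If `S ≠ 0`, then `exp S` is transcendental
by the Hermite–Lindemann theorem (`transcendental_exp`). If `S = 0`, all roots `a` have `1 ≤ ‖a‖`,
and `M(p)` is the absolute value of the leading coefficient times the product of all roots, which is
that of the constant coefficient.

The Hermite–Lindemann theorem is deduced from the simultaneous approximation of exponentials
`LindemannWeierstrass.exp_polynomial_approx`. An integral relation `Q (exp α) = 0` is an element
of the group ring `ℤ[K]` of the additive group of a Galois number field `K ∋ α`, killed by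
`[γ] ↦ exp γ`. Multiplying it by its conjugates, and then by the sum over a Galois orbit of
exponents, makes it Galois invariant with a nonzero coefficient at the exponent `0`
(`exists_galoisMap_invariant`). For such a relation, the approximation produces nonzero integers of
absolute value less than `1` (`intCast_add_sum_exp_ne_zero`).
-/

/-! ### The areal Mahler measure in terms of the roots -/

section Areal

open MeasureTheory Set

/-- An integrable function on the plane stays integrable in polar coordinates. This is what
Fubini's theorem needs after `Complex.integral_comp_polarCoord_symm`. -/
theorem integrableOn_comp_polarCoord_symm {f : ℂ → ℝ} (hf : Integrable f) :
    IntegrableOn (fun p : ℝ × ℝ => p.1 * f (Complex.polarCoord.symm p)) polarCoord.target := by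
  have h1 : Integrable (fun p : ℝ × ℝ => f (Complex.measurableEquivRealProd.symm p)) :=
    (Complex.volume_preserving_equiv_real_prod.symm).integrable_comp_emb
      Complex.measurableEquivRealProd.symm.measurableEmbedding |>.2 hf
  have h2 := (integrableOn_image_iff_integrableOn_abs_det_fderiv_smul volume
    polarCoord.open_target.measurableSet
    (fun p _ => (hasFDerivAt_polarCoord_symm p).hasFDerivWithinAt) polarCoord.symm.injOn
    (fun p : ℝ × ℝ => f (Complex.measurableEquivRealProd.symm p))).1 h1.integrableOn
  refine h2.congr_fun (fun p hp => ?_) polarCoord.open_target.measurableSet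
  simp only [det_fderivPolarCoordSymm, smul_eq_mul, abs_of_pos (show 0 < p.1 from hp.1)]
  rw [Complex.measurableEquivRealProd_symm_polarCoord_symm_apply]

theorem integral_Ioo_polarCoord_symm (f : ℂ → ℝ) (r : ℝ) :
    ∫ θ in Ioo (-Real.pi) Real.pi, f (Complex.polarCoord.symm (r, θ)) =
      2 * Real.pi * Real.circleAverage f 0 r := by
  rw [Real.circleAverage_eq_integral_add (-Real.pi),
    intervalIntegral.integral_comp_add_right (fun θ => f (circleMap 0 r θ)),
    ← integral_Ioc_eq_integral_Ioo, ← intervalIntegral.integral_of_le (by linarith [Real.pi_pos]),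
    smul_eq_mul, mul_inv_cancel_left₀ (by positivity)]
  rw [show 0 + -Real.pi = -Real.pi by ring, show 2 * Real.pi + -Real.pi = Real.pi by ring]
  refine intervalIntegral.integral_congr fun θ _ => ?_
  simp [circleMap, Complex.exp_mul_I]

/-- Integration over a disk by circles. -/
theorem setIntegral_ball_eq_integral_circleAverage {f : ℂ → ℝ} {R : ℝ} (hR : 0 ≤ R)
    (hf : IntegrableOn f (Metric.ball 0 R)) :
    ∫ z in Metric.ball (0 : ℂ) R, f z =
      2 * Real.pi * ∫ r in (0 : ℝ)..R, r * Real.circleAverage f 0 r := by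
  have hf' := (integrable_indicator_iff Metric.isOpen_ball.measurableSet).2 hf
  have hint := integrableOn_comp_polarCoord_symm hf'
  rw [← integral_indicator Metric.isOpen_ball.measurableSet,
    ← Complex.integral_comp_polarCoord_symm]
  simp only [smul_eq_mul]
  rw [polarCoord_target] at hint ⊢
  rw [Measure.volume_eq_prod] at hint ⊢
  have hsub : Ioo (0 : ℝ) R ⊆ Ioi 0 := fun r hr => hr.1
  rw [setIntegral_prod _ hint, intervalIntegral.integral_of_le hR,
    integral_Ioc_eq_integral_Ioo, ← integral_const_mul]
  rw [setIntegral_eq_of_subset_of_forall_sdiff_eq_zero measurableSet_Ioi hsub]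
  · refine setIntegral_congr_fun measurableSet_Ioo fun r hr => ?_
    have hmem (θ : ℝ) : Complex.polarCoord.symm (r, θ) ∈ Metric.ball (0 : ℂ) R := by
      rw [mem_ball_zero_iff, Complex.norm_polarCoord_symm, abs_of_pos hr.1]
      exact hr.2
    simp only [indicator_of_mem (hmem _)]
    rw [integral_const_mul, integral_Ioo_polarCoord_symm]
    ring
  · intro r hr
    have hmem (θ : ℝ) : Complex.polarCoord.symm (r, θ) ∉ Metric.ball (0 : ℂ) R := by
      rw [mem_ball_zero_iff, Complex.norm_polarCoord_symm, abs_of_pos hr.1]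
      exact fun h => hr.2 ⟨hr.1, h⟩
    simp only [indicator_of_notMem (hmem _), mul_zero, integral_zero]

theorem circleAverage_log_norm_sub_eq_log_max {r : ℝ} (hr : 0 < r) (a : ℂ) :
    Real.circleAverage (fun z => Real.log ‖z - a‖) 0 r = Real.log (max r ‖a‖) := by
  rw [circleAverage_log_norm_sub_const_eq_log_radius_add_posLog hr.ne', zero_sub, norm_neg,
    Real.posLog_eq_log_max_one (by positivity), ← Real.log_mul hr.ne' (by positivity),
    mul_max_of_nonneg _ _ hr.le, mul_one, mul_inv_cancel_left₀ hr.ne']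

theorem integral_mul_log_max {t : ℝ} (h0 : 0 ≤ t) :
    ∫ r in (0 : ℝ)..1, r * Real.log (max r t) =
      (Real.log (max 1 t) + (min 1 t ^ 2 - 1) / 2) / 2 := by
  rcases le_total 1 t with h1 | h1
  · rw [max_eq_right h1, min_eq_left h1, intervalIntegral.integral_congr
      (g := fun r => r * Real.log t), intervalIntegral.integral_mul_const, integral_id]
    · ring
    · intro r hr
      rw [uIcc_of_le zero_le_one] at hr
      simp only [max_eq_right (hr.2.trans h1)]
  · have hlow : EqOn (fun r => r * Real.log (max r t)) (fun r => r * Real.log t) (uIcc 0 t) := by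
      intro r hr
      rw [uIcc_of_le h0] at hr
      simp only [max_eq_right hr.2]
    have hhigh : EqOn (fun r => r * Real.log (max r t)) (fun r => r * Real.log r) (uIcc t 1) := by
      intro r hr
      rw [uIcc_of_le h1] at hr
      simp only [max_eq_left hr.1]
    have hi1 : IntervalIntegrable (fun r => r * Real.log (max r t)) volume 0 t :=
      ((Continuous.intervalIntegrable (by fun_prop) 0 t).congr
        (hlow.symm.mono uIoc_subset_uIcc))
    have hi2 : IntervalIntegrable (fun r => r * Real.log (max r t)) volume t 1 :=
      ((Real.continuous_mul_log.intervalIntegrable t 1).congr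
        (hhigh.symm.mono uIoc_subset_uIcc))
    have hFTC : ∫ r in t..1, r * Real.log r =
        (1 / 2 * (1 * (1 * Real.log 1)) - 1 ^ 2 / 4) -
          (1 / 2 * (t * (t * Real.log t)) - t ^ 2 / 4) := by
      refine intervalIntegral.integral_eq_sub_of_hasDerivAt_of_le
        (f := fun r => 1 / 2 * (r * (r * Real.log r)) - r ^ 2 / 4) h1 ?_ ?_
        (Real.continuous_mul_log.intervalIntegrable t 1)
      · have := Real.continuous_mul_log
        exact Continuous.continuousOn (by fun_prop)
      · intro r hr
        have hr0 : r ≠ 0 := (h0.trans_lt hr.1).ne'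
        convert! (((hasDerivAt_id r).mul (Real.hasDerivAt_mul_log hr0)).const_mul (1 / 2)).sub
          ((hasDerivAt_pow 2 r).div_const 4) using 1
        simp
        ring
    rw [← intervalIntegral.integral_add_adjacent_intervals hi1 hi2,
      intervalIntegral.integral_congr hlow, intervalIntegral.integral_congr hhigh, hFTC,
      intervalIntegral.integral_mul_const, integral_id, max_eq_left h1, min_eq_right h1,
      Real.log_one]
    ring

theorem arealMahlerMeasure_X_sub_C (a : ℂ) :
    arealMahlerMeasure (Polynomial.X - Polynomial.C a) =
      max 1 ‖a‖ * Real.exp ((min 1 ‖a‖ ^ 2 - 1) / 2) := by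
  have hne := Polynomial.X_sub_C_ne_zero a
  have hint := integrableOn_log_norm_eval _ hne
  rw [arealMahlerMeasure, if_neg hne,
    setIntegral_ball_eq_integral_circleAverage zero_le_one hint,
    intervalIntegral.integral_congr_Ioo_of_le zero_le_one
      (g := fun r => r * Real.log (max r ‖a‖)),
    integral_mul_log_max (norm_nonneg a)]
  · have : 1 / Real.pi * (2 * Real.pi *
        ((Real.log (max 1 ‖a‖) + (min 1 ‖a‖ ^ 2 - 1) / 2) / 2)) =
        Real.log (max 1 ‖a‖) + (min 1 ‖a‖ ^ 2 - 1) / 2 := by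
      field_simp
    rw [this, Real.exp_add, Real.exp_log (by positivity)]
  · intro r hr
    simp [circleAverage_log_norm_sub_eq_log_max hr.1]

theorem arealMahlerMeasure_C (c : ℂ) : arealMahlerMeasure (Polynomial.C c) = ‖c‖ := by
  by_cases hc : c = 0
  · simp [arealMahlerMeasure, hc]
  · rw [arealMahlerMeasure, if_neg (Polynomial.C_ne_zero.2 hc)]
    simp [measureReal_def, Complex.volume_ball, Real.exp_log (norm_pos_iff.2 hc)]

theorem arealMahlerMeasure_mul (p q : Polynomial ℂ) :
    arealMahlerMeasure (p * q) = arealMahlerMeasure p * arealMahlerMeasure q := by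
  by_cases hp : p = 0
  · simp [arealMahlerMeasure, hp]
  by_cases hq : q = 0
  · simp [arealMahlerMeasure, hq]
  rw [arealMahlerMeasure, arealMahlerMeasure, arealMahlerMeasure, if_neg hp, if_neg hq,
    if_neg (mul_ne_zero hp hq), ← Real.exp_add, ← mul_add,
    ← integral_add (integrableOn_log_norm_eval p hp) (integrableOn_log_norm_eval q hq)]
  congr 2
  have hfin : ∀ᵐ z : ℂ, z ∉ ((p * q).roots.toFinset : Set ℂ) :=
    measure_eq_zero_iff_ae_notMem.1 (Finset.measure_zero _ _)
  refine integral_congr_ae ?_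
  filter_upwards [ae_restrict_of_ae hfin] with z hz
  have hz0 : ¬ (p.eval z * q.eval z = 0) := by simpa [hp, hq] using hz
  rw [mul_eq_zero, not_or] at hz0
  simp [Real.log_mul (norm_ne_zero_iff.2 hz0.1) (norm_ne_zero_iff.2 hz0.2)]

/-- Each root `a` multiplies Mahler's measure by `max 1 ‖a‖`, and the areal measure by the same
number times the exponential factor `exp ((min 1 ‖a‖ ^ 2 - 1) / 2)`, which is `1` for roots outside
the open disk. -/
theorem arealMahlerMeasure_eq_mahlerMeasure_mul_exp (p : Polynomial ℂ) :
    arealMahlerMeasure p =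
      p.mahlerMeasure * Real.exp (p.roots.map fun a => (min 1 ‖a‖ ^ 2 - 1) / 2).sum := by
  have key (s : Multiset ℂ) :
      arealMahlerMeasure (s.map fun a => Polynomial.X - Polynomial.C a).prod =
        (s.map fun a => max 1 ‖a‖).prod *
          Real.exp (s.map fun a => (min 1 ‖a‖ ^ 2 - 1) / 2).sum := by
    induction s using Multiset.induction_on with
    | empty => simpa using arealMahlerMeasure_C 1
    | cons a s ih =>
      simp only [Multiset.map_cons, Multiset.prod_cons, Multiset.sum_cons, arealMahlerMeasure_mul,
        arealMahlerMeasure_X_sub_C, ih, Real.exp_add]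
      ring
  conv_lhs => rw [(IsAlgClosed.splits p).eq_prod_roots]
  rw [arealMahlerMeasure_mul, arealMahlerMeasure_C, key,
    Polynomial.mahlerMeasure_eq_leadingCoeff_mul_prod_roots, mul_assoc]

end Areal

open Polynomial

/-! ### Symmetric relations between exponentials -/

/-- Clearing denominators: if `f` kills `x`, a power of the leading coefficient of `f` makes every
integral polynomial expression in `x` of bounded degree an algebraic integer. -/
theorem isIntegral_leadingCoeff_pow_mul_aeval {x : ℂ} {f : ℤ[X]} (hx : aeval x f = 0)
    (g : ℤ[X]) {m : ℕ} (hm : g.natDegree ≤ m) :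
    IsIntegral ℤ ((f.leadingCoeff : ℂ) ^ m * aeval x g) := by
  have hax : IsIntegral ℤ ((f.leadingCoeff : ℂ) * x) := by
    simpa [zsmul_eq_mul] using isIntegral_leadingCoeff_smul f x hx
  have hint (k : ℤ) : IsIntegral ℤ (k : ℂ) := isIntegral_algebraMap (R := ℤ) (A := ℂ) (x := k)
  rw [aeval_eq_sum_range, Finset.mul_sum]
  refine IsIntegral.sum _ fun i hi => ?_
  have hi' : i ≤ m := (Nat.lt_succ_iff.1 (Finset.mem_range.1 hi)).trans hm
  have : (f.leadingCoeff : ℂ) ^ m * g.coeff i • x ^ i =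
      (f.leadingCoeff : ℂ) ^ (m - i) * (g.coeff i : ℂ) * ((f.leadingCoeff : ℂ) * x) ^ i := by
    obtain ⟨d, rfl⟩ := Nat.exists_eq_add_of_le hi'
    rw [zsmul_eq_mul, Nat.add_sub_cancel_left, pow_add, mul_pow]
    ring
  rw [this]
  exact (((hint _).pow _).mul (hint _)).mul (hax.pow _)

theorem exists_int_eq_of_isIntegral_ratCast {q : ℚ} (h : IsIntegral ℤ (q : ℂ)) :
    ∃ m : ℤ, (m : ℂ) = q := by
  have h' : IsIntegral ℤ q :=
    (isIntegral_algHom_iff (algebraMap ℚ ℂ).toIntAlgHom (algebraMap ℚ ℂ).injective).1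
      (by simpa using h)
  obtain ⟨m, hm⟩ := IsIntegrallyClosed.isIntegral_iff.1 h'
  exact ⟨m, by rw [← hm]; simp⟩

theorem exists_int_polynomial_forall_aeval_eq_zero (s : Finset ℂ) (h0 : (0 : ℂ) ∉ s)
    (halg : ∀ γ ∈ s, IsAlgebraic ℤ γ) :
    ∃ f : ℤ[X], f.eval 0 ≠ 0 ∧ ∀ γ ∈ s, aeval γ f = 0 := by
  have h (γ : ℂ) : ∃ f : ℤ[X], f.eval 0 ≠ 0 ∧ (γ ∈ s → aeval γ f = 0) := by
    by_cases hγ : γ ∈ s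
    · obtain ⟨f, hf, hf'⟩ := (halg γ hγ).exists_nonzero_coeff_and_aeval_eq_zero
        (mem_nonZeroDivisors_of_ne_zero (ne_of_mem_of_not_mem hγ h0))
      exact ⟨f, by rwa [← coeff_zero_eq_eval_zero], fun _ => hf'⟩
    · exact ⟨1, by simp, fun h => absurd h hγ⟩
  choose F hF hF' using h
  refine ⟨∏ γ ∈ s, F γ, ?_, fun γ hγ => ?_⟩
  · rw [eval_prod]
    exact Finset.prod_ne_zero_iff.2 fun γ _ => hF γ
  · rw [map_prod]
    exact Finset.prod_eq_zero hγ (hF' γ hγ)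

/-- There is no integral relation between exponentials of algebraic numbers that has a nonzero
constant term and is stable under conjugation; the stability enters only through `hrat`. -/
theorem intCast_add_sum_exp_ne_zero (s : Finset ℂ) (w : ℂ → ℤ) {k : ℤ} (hk : k ≠ 0)
    (h0 : (0 : ℂ) ∉ s) (halg : ∀ γ ∈ s, IsAlgebraic ℤ γ)
    (hrat : ∀ g : ℤ[X], ∃ r : ℚ, ∑ γ ∈ s, w γ * aeval γ g = r) :
    (k : ℂ) + ∑ γ ∈ s, w γ * Complex.exp γ ≠ 0 := by
  -- A relation yields integers `M`, one for each large prime `p`, with `M ≠ 0` and `|M| < 1`.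
  intro hsum
  obtain ⟨f, hf0, hf⟩ := exists_int_polynomial_forall_aeval_eq_zero s h0 halg
  have hfne : f ≠ 0 := by rintro rfl; simp at hf0
  obtain ⟨c, hc⟩ := LindemannWeierstrass.exp_polynomial_approx f hf0
  set a : ℤ := f.leadingCoeff
  have ha0 : a ≠ 0 := leadingCoeff_ne_zero.2 hfne
  set d := f.natDegree
  set W : ℝ := ∑ γ ∈ s, ‖(w γ : ℂ)‖
  set B : ℝ := |(a : ℝ)| ^ d * |c| with hB
  -- The size `W * B * (B ^ (p - 1) / (p - 1)!)` of the integer built below drops under `1`.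
  have hlim : Filter.Tendsto (fun n : ℕ => W * B * (B ^ n / n.factorial)) Filter.atTop
      (nhds 0) := by
    simpa using (FloorSemiring.tendsto_pow_div_factorial_atTop B).const_mul (W * B)
  obtain ⟨N, hN⟩ := Filter.eventually_atTop.1 (hlim.eventually_lt_const zero_lt_one)
  obtain ⟨p, hpN, hp⟩ :=
    Nat.exists_infinite_primes (N + (f.eval 0).natAbs + a.natAbs + k.natAbs + 2)
  obtain ⟨n, hn, g, hg, happ⟩ := hc p (by omega) hp
  obtain ⟨r, hr⟩ := hrat g
  have hint : IsIntegral ℤ ((((a : ℚ) ^ (p * d) * r : ℚ)) : ℂ) := by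
    push_cast
    rw [← hr, Finset.mul_sum]
    refine IsIntegral.sum _ fun γ hγ => ?_
    have h1 := isIntegral_leadingCoeff_pow_mul_aeval (hf γ hγ) g (hg.trans (Nat.sub_le _ 1))
    have h2 : IsIntegral ℤ (w γ : ℂ) := isIntegral_algebraMap (R := ℤ) (A := ℂ) (x := w γ)
    convert! h2.mul h1 using 1
    ring
  obtain ⟨S, hS⟩ := exists_int_eq_of_isIntegral_ratCast hint
  have hpdvd {x : ℤ} (hx : x ≠ 0) (hxp : x.natAbs < p) : ¬ (p : ℤ) ∣ x := fun h =>
    absurd (Nat.le_of_dvd (Int.natAbs_pos.2 hx) (Int.natCast_dvd.1 h)) (by omega)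
  have hpp : Prime (p : ℤ) := Nat.prime_iff_prime_int.1 hp
  -- The integer `M` is nonzero because `p` divides its second summand but not the first.
  set M : ℤ := a ^ (p * d) * n * k + p * S with hM
  have hM0 : M ≠ 0 := by
    intro h
    have h1 : (p : ℤ) ∣ a ^ (p * d) * n * k :=
      (dvd_add_left (dvd_mul_right _ S)).1 (by rw [← hM, h]; exact dvd_zero _)
    rcases hpp.dvd_or_dvd h1 with h1 | h1
    · rcases hpp.dvd_or_dvd h1 with h1 | h1
      · exact hpdvd ha0 (by omega) (hpp.dvd_of_dvd_pow h1)
      · exact hn h1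
    · exact hpdvd hk (by omega) h1
  have hMeq : (M : ℂ) =
      -((a : ℂ) ^ (p * d) * ∑ γ ∈ s, w γ * (n • Complex.exp γ - p • aeval γ g)) := by
    have h1 : ∑ γ ∈ s, (w γ : ℂ) * (n • Complex.exp γ - p • aeval γ g) =
        n * ∑ γ ∈ s, w γ * Complex.exp γ - p * ∑ γ ∈ s, w γ * aeval γ g := by
      rw [Finset.mul_sum, Finset.mul_sum, ← Finset.sum_sub_distrib]
      refine Finset.sum_congr rfl fun γ _ => ?_
      simp only [zsmul_eq_mul, nsmul_eq_mul]
      ring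
    rw [h1, hr, eq_neg_of_add_eq_zero_right hsum, hM]
    push_cast at hS ⊢
    rw [hS]
    ring
  have hbound : ‖(M : ℂ)‖ < 1 := by
    have h1 : ‖∑ γ ∈ s, (w γ : ℂ) * (n • Complex.exp γ - p • aeval γ g)‖ ≤
        W * (|c| ^ p / (p - 1).factorial) := by
      refine (norm_sum_le _ _).trans ?_
      rw [Finset.sum_mul]
      refine Finset.sum_le_sum fun γ hγ => ?_
      rw [norm_mul]
      refine mul_le_mul_of_nonneg_left ?_ (norm_nonneg _)
      refine (happ ((mem_aroots.2 ⟨hfne, hf γ hγ⟩))).trans ?_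
      rw [← abs_pow]
      exact div_le_div_of_nonneg_right (le_abs_self _) (by positivity)
    rw [hMeq, norm_neg, norm_mul, norm_pow, Complex.norm_intCast]
    refine (mul_le_mul_of_nonneg_left h1 (by positivity)).trans_lt ?_
    have h2 := hN (p - 1) (by omega)
    convert! h2 using 1
    rw [mul_div_assoc', mul_div_assoc', mul_div_assoc', mul_assoc W, ← pow_succ',
      Nat.sub_add_cancel hp.one_le, hB, mul_pow, ← pow_mul, mul_comm p d]
    ring
  rw [Complex.norm_intCast, ← Int.cast_abs] at hbound
  exact hM0 (Int.abs_lt_one_iff.1 (by exact_mod_cast hbound))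

/-! ### The Hermite–Lindemann theorem -/

section GroupRing

variable {K : Type*} [Field K]

/-- The ring homomorphism `∑ c_γ [γ] ↦ ∑ c_γ exp (φ γ)` from the integral group ring of the additive
group of `K` to `ℂ`. -/
noncomputable def expSum (φ : K →+* ℂ) : AddMonoidAlgebra ℤ K →ₐ[ℤ] ℂ :=
  AddMonoidAlgebra.lift ℤ ℂ K
    (Complex.expMonoidHom.comp (AddMonoidHom.toMultiplicative φ.toAddMonoidHom))

theorem expSum_apply (φ : K →+* ℂ) (H : AddMonoidAlgebra ℤ K) :
    expSum φ H = ∑ γ ∈ H.coeff.support, (H.coeff γ : ℂ) * Complex.exp (φ γ) := by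
  rw [expSum, AddMonoidAlgebra.lift_apply, Finsupp.sum]
  simp [Complex.expMonoidHom]

variable [Algebra ℚ K]

/-- The action of the Galois group on the exponents of an element of the group ring. -/
noncomputable def galoisMap (σ : K ≃ₐ[ℚ] K) :
    AddMonoidAlgebra ℤ K ≃ₐ[ℤ] AddMonoidAlgebra ℤ K :=
  AddMonoidAlgebra.domCongr ℤ ℤ (σ : K ≃+ K)

theorem coeff_galoisMap (σ : K ≃ₐ[ℚ] K) (H : AddMonoidAlgebra ℤ K) (γ : K) :
    (galoisMap σ H).coeff γ = H.coeff (σ.symm γ) := by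
  rw [galoisMap, AddMonoidAlgebra.coeff_domCongr]
  rfl

theorem galoisMap_mul (σ τ : K ≃ₐ[ℚ] K) (H : AddMonoidAlgebra ℤ K) :
    galoisMap (σ * τ) H = galoisMap σ (galoisMap τ H) := by
  ext γ
  simp only [coeff_galoisMap]
  rfl

theorem coeff_apply_of_forall_galoisMap_eq {H : AddMonoidAlgebra ℤ K}
    (hH : ∀ σ, galoisMap σ H = H) (σ : K ≃ₐ[ℚ] K) (γ : K) : H.coeff (σ γ) = H.coeff γ := by
  conv_lhs => rw [← hH σ, coeff_galoisMap, σ.symm_apply_apply]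

theorem aeval_single_ne_zero {a : K} (ha : a ≠ 0) {Q : ℤ[X]} (hQ : Q ≠ 0) :
    aeval (AddMonoidAlgebra.single a (1 : ℤ)) Q ≠ 0 := by
  classical
  have : CharZero K := algebraRat.charZero K
  obtain ⟨n, hn⟩ : ∃ n, Q.coeff n ≠ 0 := by
    by_contra! h
    exact hQ (by ext n; simpa using h n)
  intro h
  have h1 := congrArg (fun q => q.coeff (n • a)) h
  simp only [aeval_eq_sum_range, AddMonoidAlgebra.single_pow, one_pow] at h1
  simp [Finsupp.single_apply, ha] at h1
  exact hn (by simpa using h1 (le_natDegree_of_ne_zero hn))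

theorem expSum_ne_zero_of_forall_galoisMap_eq [FiniteDimensional ℚ K] [IsGalois ℚ K] (φ : K →+* ℂ)
    {H : AddMonoidAlgebra ℤ K} (hH : ∀ σ, galoisMap σ H = H) (h0 : H.coeff 0 ≠ 0) :
    expSum φ H ≠ 0 := by
  classical
  have hcoeff := coeff_apply_of_forall_galoisMap_eq hH
  set t := H.coeff.support.erase 0 with ht
  have hw (γ : K) : Function.extend φ H.coeff 0 (φ γ) = H.coeff γ := φ.injective.extend_apply _ _ _
  have key := intCast_add_sum_exp_ne_zero (t.map ⟨φ, φ.injective⟩) (Function.extend φ H.coeff 0) h0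
    (by simp [ht]) ?_ ?_
  · rw [expSum_apply, ← Finset.add_sum_erase _ _ (Finsupp.mem_support_iff.2 h0)]
    simpa [hw] using key
  · intro z hz
    obtain ⟨γ, -, rfl⟩ := Finset.mem_map.1 hz
    have hγ : IsAlgebraic ℤ γ :=
      (IsFractionRing.isAlgebraic_iff ℤ ℚ K).2 (Algebra.IsAlgebraic.isAlgebraic γ)
    exact hγ.algHom φ.toIntAlgHom
  · intro g
    set x : K := ∑ γ ∈ t, (H.coeff γ : K) * aeval γ g
    have hx : x ∈ Set.range (algebraMap ℚ K) := by
      rw [IsGalois.mem_range_algebraMap_iff_fixed]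
      intro σ
      simp only [x, map_sum, map_mul, map_intCast]
      refine Finset.sum_equiv σ.toEquiv (fun γ => ?_) fun γ _ => ?_
      · simp [ht, hcoeff]
      · have h1 : σ (aeval γ g) = aeval (σ γ) g :=
          (aeval_algHom_apply (σ : K →+* K).toIntAlgHom γ g).symm
        simp [hcoeff, h1]
    obtain ⟨r, hr⟩ := hx
    refine ⟨r, ?_⟩
    have h2 : φ x = r := by rw [← hr]; simp
    rw [← h2]
    simp only [x, map_sum, map_mul, map_intCast, Finset.sum_map, Function.Embedding.coeFn_mk, hw]
    refine Finset.sum_congr rfl fun γ _ => ?_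
    congr 1
    exact aeval_algHom_apply φ.toIntAlgHom γ g

variable [FiniteDimensional ℚ K]

/-- The product of the conjugates of `q` is Galois invariant; a further product with a sum over an
orbit of exponents moves an exponent that occurs to `0`. -/
theorem exists_galoisMap_invariant {q : AddMonoidAlgebra ℤ K} (hq : q ≠ 0) :
    ∃ H : AddMonoidAlgebra ℤ K, q ∣ H ∧ (∀ σ, galoisMap σ H = H) ∧ H.coeff 0 ≠ 0 := by
  classical
  have : CharZero K := algebraRat.charZero K
  set F : AddMonoidAlgebra ℤ K := ∏ σ : K ≃ₐ[ℚ] K, galoisMap σ q with hFdef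
  have hF (τ) : galoisMap τ F = F := by
    rw [hFdef, map_prod]
    simp only [← galoisMap_mul]
    exact Fintype.prod_equiv (Equiv.mulLeft τ) _ _ fun σ => rfl
  have hF0 : F ≠ 0 :=
    Finset.prod_ne_zero_iff.2 fun σ _ => (map_ne_zero_iff _ (galoisMap σ).injective).2 hq
  obtain ⟨γ, hγ⟩ : ∃ γ, F.coeff γ ≠ 0 := by
    by_contra! h
    exact hF0 (by ext γ; simpa using h γ)
  set O : AddMonoidAlgebra ℤ K := ∑ σ : K ≃ₐ[ℚ] K, AddMonoidAlgebra.single (-(σ γ)) 1 with hOdef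
  have hO (τ) : galoisMap τ O = O := by
    rw [hOdef, map_sum]
    refine Fintype.sum_equiv (Equiv.mulLeft τ) _ _ fun σ => ?_
    simp only [galoisMap, AddMonoidAlgebra.domCongr_single, map_neg]
    rfl
  refine ⟨F * O, ?_, fun σ => by rw [map_mul, hF, hO], ?_⟩
  · refine Dvd.dvd.mul_right ?_ _
    have h1 : galoisMap (1 : K ≃ₐ[ℚ] K) q = q := by
      ext δ
      rw [coeff_galoisMap]
      rfl
    calc q = galoisMap (1 : K ≃ₐ[ℚ] K) q := h1.symm
      _ ∣ F := Finset.dvd_prod_of_mem _ (Finset.mem_univ _)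
  · have : (F * O).coeff 0 = Fintype.card (K ≃ₐ[ℚ] K) * F.coeff γ := by
      rw [hOdef, Finset.mul_sum]
      simp [AddMonoidAlgebra.coeff_mul_single_apply, coeff_apply_of_forall_galoisMap_eq hF]
    rw [this]
    exact mul_ne_zero (by exact_mod_cast Fintype.card_ne_zero) hγ

theorem expSum_ne_zero [IsGalois ℚ K] (φ : K →+* ℂ) {q : AddMonoidAlgebra ℤ K} (hq : q ≠ 0) :
    expSum φ q ≠ 0 := by
  obtain ⟨H, hdvd, hH, h0⟩ := exists_galoisMap_invariant hq
  exact ne_zero_of_dvd_ne_zero (expSum_ne_zero_of_forall_galoisMap_eq φ hH h0) (map_dvd _ hdvd)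

end GroupRing

/-- The base field is a variable here because for `ℚ` itself the algebra structure of
`Polynomial.SplittingField` competes with the one that every field of characteristic zero has. -/
theorem exists_isGalois_mem_range {F : Type} [Field F] [CharZero F] [Algebra F ℂ] {α : ℂ}
    (hα : IsAlgebraic F α) :
    ∃ (K : Type) (_ : Field K) (_ : Algebra F K) (_ : FiniteDimensional F K) (_ : IsGalois F K)
      (φ : K →ₐ[F] ℂ), ∃ a, φ a = α := by
  set p := minpoly F α
  have hne : p ≠ 0 := minpoly.ne_zero hα.isIntegral
  have hnormal : Normal F p.SplittingField := Normal.of_isSplittingField p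
  let φ : p.SplittingField →ₐ[F] ℂ := SplittingField.lift p (IsAlgClosed.splits _)
  refine ⟨p.SplittingField, inferInstance, inferInstance, inferInstance, ⟨⟩, φ, ?_⟩
  refine (SplittingField.splits p).mem_range_of_isRoot (map_ne_zero hne) (i := φ.toRingHom) ?_
  rw [map_map, AlgHom.toRingHom_eq_coe, φ.comp_algebraMap, IsRoot, eval_map_algebraMap]
  exact minpoly.aeval F α

/-- The Hermite–Lindemann theorem. -/
theorem transcendental_exp {α : ℂ} (hα : IsAlgebraic ℚ α) (h0 : α ≠ 0) :
    Transcendental ℚ (Complex.exp α) := by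
  intro hexp
  obtain ⟨Q, hQ, hQ0⟩ := (IsFractionRing.isAlgebraic_iff ℤ ℚ ℂ).2 hexp
  obtain ⟨K, _, _, _, _, φ, a, rfl⟩ := exists_isGalois_mem_range hα
  have ha0 : a ≠ 0 := by rintro rfl; exact h0 (map_zero φ)
  refine expSum_ne_zero (φ : K →+* ℂ) (aeval_single_ne_zero ha0 hQ) ?_
  rw [← aeval_algHom_apply]
  simpa [expSum, Complex.expMonoidHom] using hQ0

/-! ### Integer polynomials -/

theorem isAlgebraic_norm {z : ℂ} (hz : IsAlgebraic ℚ z) : IsAlgebraic ℚ ‖z‖ := by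
  have hconj : IsAlgebraic ℚ (starRingEnd ℂ z) :=
    hz.algHom (starRingEnd ℂ).toRatAlgHom
  have hsq : IsAlgebraic ℚ (algebraMap ℝ ℂ (‖z‖ ^ 2)) := by
    have h : algebraMap ℝ ℂ (‖z‖ ^ 2) = z * starRingEnd ℂ z := by
      rw [Complex.mul_conj, Complex.normSq_eq_norm_sq]
      rfl
    rw [h]
    exact hz.mul hconj
  exact IsAlgebraic.of_pow two_pos
    ((isAlgebraic_algebraMap_iff (algebraMap ℝ ℂ).injective).1 hsq)

theorem isAlgebraic_of_mem_roots_map {P : ℤ[X]} {a : ℂ}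
    (ha : a ∈ (P.map (Int.castRingHom ℂ)).roots) : IsAlgebraic ℚ a := by
  have hne : P ≠ 0 := by rintro rfl; simp at ha
  refine (IsFractionRing.isAlgebraic_iff ℤ ℚ ℂ).1 ⟨P, hne, ?_⟩
  have := isRoot_of_mem_roots ha
  rwa [← algebraMap_int_eq, IsRoot, eval_map_algebraMap] at this

theorem isAlgebraic_max_one {x : ℝ} (hx : IsAlgebraic ℚ x) : IsAlgebraic ℚ (max 1 x) := by
  rcases max_choice 1 x with h | h <;> rw [h]
  exacts [isAlgebraic_one, hx]

theorem isAlgebraic_min_one {x : ℝ} (hx : IsAlgebraic ℚ x) : IsAlgebraic ℚ (min 1 x) := by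
  rcases min_choice 1 x with h | h <;> rw [h]
  exacts [isAlgebraic_one, hx]

theorem isAlgebraic_mahlerMeasure (P : ℤ[X]) :
    IsAlgebraic ℚ (P.map (Int.castRingHom ℂ)).mahlerMeasure := by
  rw [mahlerMeasure_eq_leadingCoeff_mul_prod_roots]
  refine IsAlgebraic.mul (isAlgebraic_norm ?_) ?_
  · rw [leadingCoeff_map_of_injective Int.cast_injective]
    exact isAlgebraic_intCast _
  · refine multiset_prod_mem (S := Subalgebra.algebraicClosure ℚ ℝ) _ fun x hx => ?_
    obtain ⟨a, ha, rfl⟩ := Multiset.mem_map.1 hx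
    exact isAlgebraic_max_one (isAlgebraic_norm (isAlgebraic_of_mem_roots_map ha))

theorem isAlgebraic_sum_roots (P : ℤ[X]) :
    IsAlgebraic ℚ
      ((P.map (Int.castRingHom ℂ)).roots.map fun a => (min 1 ‖a‖ ^ 2 - 1) / 2).sum := by
  refine multiset_sum_mem (S := Subalgebra.algebraicClosure ℚ ℝ) _ fun x hx => ?_
  obtain ⟨a, ha, rfl⟩ := Multiset.mem_map.1 hx
  have h := isAlgebraic_min_one (isAlgebraic_norm (isAlgebraic_of_mem_roots_map ha))
  rw [div_eq_mul_inv]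
  exact ((h.pow 2).sub isAlgebraic_one).mul (isAlgebraic_natCast 2).inv

/-- Without a root in the open disk the sum is `0`, so this is what separates the two cases. -/
theorem sum_roots_neg {p : ℂ[X]} {z : ℂ} (hz : z ∈ p.roots) (hz1 : ‖z‖ < 1) :
    (p.roots.map fun a => (min 1 ‖a‖ ^ 2 - 1) / 2).sum < 0 := by
  have hle (a : ℂ) : (min 1 ‖a‖ ^ 2 - 1) / 2 ≤ 0 := by
    have : min 1 ‖a‖ ^ 2 ≤ 1 := pow_le_one₀ (by positivity) (min_le_left _ _)
    linarith
  have hlt : (min 1 ‖z‖ ^ 2 - 1) / 2 < 0 := by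
    have : ‖z‖ ^ 2 < 1 := pow_lt_one₀ (norm_nonneg z) hz1 two_ne_zero
    rw [min_eq_right hz1.le]
    linarith
  rw [← Multiset.cons_erase hz, Multiset.map_cons, Multiset.sum_cons]
  refine add_neg_of_neg_of_nonpos hlt
    ((Multiset.sum_le_card_nsmul _ 0 fun x hx => ?_).trans_eq (smul_zero _))
  obtain ⟨a, -, rfl⟩ := Multiset.mem_map.1 hx
  exact hle a

theorem mahlerMeasure_eq_norm_coeff_zero {p : ℂ[X]} (hp : ∀ a ∈ p.roots, 1 ≤ ‖a‖) :
    p.mahlerMeasure = ‖p.coeff 0‖ := by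
  rw [mahlerMeasure_eq_leadingCoeff_mul_prod_roots,
    (IsAlgClosed.splits p).coeff_zero_eq_leadingCoeff_mul_prod_roots, norm_mul, norm_mul, norm_pow,
    norm_neg, norm_one, one_pow, one_mul]
  congr 1
  refine Eq.trans ?_ (map_multiset_prod (normHom : ℂ →*₀ ℝ) p.roots).symm
  congr 1
  exact Multiset.map_congr rfl fun a ha => max_eq_right (hp a ha)

theorem transcendental_mul_exp {m x : ℝ} (hm : IsAlgebraic ℚ m) (hm0 : m ≠ 0)
    (hx : IsAlgebraic ℚ x) (hx0 : x ≠ 0) : Transcendental ℚ (m * Real.exp x) := by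
  intro h
  have h1 : IsAlgebraic ℚ (Real.exp x) := by
    simpa [hm0] using hm.inv.mul h
  refine transcendental_exp (α := x) (hx.algebraMap (A := ℂ)) (by exact_mod_cast hx0) ?_
  rw [← Complex.ofReal_exp]
  exact h1.algebraMap

theorem proposition1p5 (P : Polynomial ℤ) (hP : P ≠ 0) :
    ((∃ z : ℂ, ‖z‖ < 1 ∧ Polynomial.aeval z P = 0) →
      Transcendental ℚ (arealMahlerMeasure (P.map (Int.castRingHom ℂ)))) ∧
    ((¬ ∃ z : ℂ, ‖z‖ < 1 ∧ Polynomial.aeval z P = 0) →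
      arealMahlerMeasure (P.map (Int.castRingHom ℂ)) =
          (P.map (Int.castRingHom ℂ)).mahlerMeasure ∧
        (P.map (Int.castRingHom ℂ)).mahlerMeasure = |(P.coeff 0 : ℝ)| ∧
        ∃ m : ℤ, arealMahlerMeasure (P.map (Int.castRingHom ℂ)) = (m : ℝ)) := by
  set p := P.map (Int.castRingHom ℂ) with hpdef
  have hp0 : p ≠ 0 := (Polynomial.map_ne_zero_iff Int.cast_injective).2 hP
  have hroot (z : ℂ) : z ∈ p.roots ↔ aeval z P = 0 := by
    rw [mem_roots hp0, IsRoot, hpdef, ← algebraMap_int_eq, eval_map_algebraMap]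
  rw [arealMahlerMeasure_eq_mahlerMeasure_mul_exp]
  constructor
  · rintro ⟨z, hz1, hz⟩
    exact transcendental_mul_exp (isAlgebraic_mahlerMeasure P)
      (mahlerMeasure_pos_of_ne_zero hp0).ne' (isAlgebraic_sum_roots P)
      (sum_roots_neg ((hroot z).2 hz) hz1).ne
  · intro h
    have hout (a : ℂ) (ha : a ∈ p.roots) : 1 ≤ ‖a‖ := by
      by_contra! hlt
      exact h ⟨a, hlt, (hroot a).1 ha⟩
    have hsum : (p.roots.map fun a => (min 1 ‖a‖ ^ 2 - 1) / 2).sum = 0 := by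
      refine Multiset.sum_eq_zero fun x hx => ?_
      obtain ⟨a, ha, rfl⟩ := Multiset.mem_map.1 hx
      simp [min_eq_left (hout a ha)]
    have hM : p.mahlerMeasure = |(P.coeff 0 : ℝ)| := by
      rw [mahlerMeasure_eq_norm_coeff_zero hout]
      simp [hpdef]
    rw [hsum, Real.exp_zero, mul_one]
    exact ⟨rfl, hM, |P.coeff 0|, by rw [hM, Int.cast_abs]⟩
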